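/- Let $X$ be a topological space. A neighborhood assignment on $X$ is a map $U$ assigning to each $x\in X$ an open set $U(x)$ with $x\in U(x)$; a set $A\subseteq X$ pins down $U$ if $A\cap U(x)\neq\emptyset$ for all $x\in X$. The pinning down number $\mathrm{pd}(X)$ is the smallest cardinal $\kappa$ such that every neighborhood assignment on $X$ is pinned down by some set $A \subseteq X$ of cardinality $\kappa$. Let $d(X)$ be the density of $X$, i.e. the smallest cardinality of a dense subset of $X$, and let the dispersion character $\Delta(X)$ be the smallest cardinality of a non-empty open subset of $X$. Theorem. If $X$ is a regular space (any point and any closed set not containing it have disjoint neighborhoods; no $T_1$ axiom is needed) such that $\mathrm{pd}(X)<d(X)$, then $\Delta(X)<2^{\mathrm{pd}(X)}$. -/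

import Mathlib

universe u

open Cardinal

/-- A neighborhood assignment on `X`: every point `x` is assigned an open set `U x` containing it. -/
def IsNeighborhoodAssignment {X : Type u} [TopologicalSpace X] (U : X → Set X) : Prop :=
  ∀ x, IsOpen (U x) ∧ x ∈ U x

/-- The set `A` pins down the neighborhood assignment `U`: it meets every `U x`. -/
def PinsDown {X : Type u} (A : Set X) (U : X → Set X) : Prop :=
  ∀ x, (A ∩ U x).Nonempty

/-- The pinning down number `pd(X)`: the smallest cardinal `κ` such that every neighborhood
assignment on `X` can be pinned down by a set of size `κ`. The set of such `κ` contains `#X`. -/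
noncomputable def pinningDownNumber (X : Type u) [TopologicalSpace X] : Cardinal.{u} :=
  sInf {κ | ∀ U : X → Set X, IsNeighborhoodAssignment U → ∃ A : Set X, #A = κ ∧ PinsDown A U}

/-- The density `d(X)`: the smallest cardinality of a dense subset of `X`. -/
noncomputable def densityNumber (X : Type u) [TopologicalSpace X] : Cardinal.{u} :=
  sInf {κ | ∃ D : Set X, Dense D ∧ #D = κ}

/-- The dispersion character `Δ(X)`: the smallest cardinality of a nonempty open subset of `X`
(with value `0` if `X` is empty). -/
noncomputable def dispersionCharacter (X : Type u) [TopologicalSpace X] : Cardinal.{u} :=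
  sInf {κ | ∃ G : Set X, IsOpen G ∧ G.Nonempty ∧ #G = κ}

open Set

/-! Put κ = pd(X) and suppose every nonempty open set has at least 2^κ points; a dense set of size
at most κ is built. If each member of a family of open sets is at least as large as the index set,
distinct points can be chosen in the members, so a single neighborhood assignment carries the whole
family and one set of size at most κ meets every member.

For infinite κ, take a maximal disjoint family of open sets of size at most 2^κ. Disjointness leaves
at most κ of them, so their union Y has at most 2^κ points and at most 2^κ subsets of size at most
κ; were none dense in Y, pinning all complements of their closures would be contradictory. Off the
closure of Y, open sets exceed 2^κ, which forces at most 2^κ regular open sets; all can be pinned at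
once, and by regularity they form a base there. For finite κ, a largest disjoint open family
suffices. -/

/-- A family of sets, each at least as large as the index type, has an injective choice function. -/
theorem exists_injective_forall_mem {I X : Type u} (G : I → Set X) (hG : ∀ i, #I ≤ #(G i)) :
    ∃ f : I → X, Function.Injective f ∧ ∀ i, f i ∈ G i := by
  obtain ⟨r, hr, hrI⟩ := Cardinal.exists_ord_eq I
  have key : ∀ (i : I) (g : ∀ j, r j i → X), ∃ x ∈ G i, ∀ j (hj : r j i), g j hj ≠ x := by
    intro i g
    by_contra! hcon
    have hsub : G i ⊆ range (fun j : {j // r j i} => g j.1 j.2) := by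
      intro x hx
      obtain ⟨j, hj, hjx⟩ := hcon x hx
      exact ⟨⟨j, hj⟩, hjx⟩
    -- `r` has the least order type possible on `I`, so fewer than `#I` points are already used at
    -- stage `i`.
    have hlt : #{j // r j i} < #I := Cardinal.card_typein_lt i hrI
    exact absurd ((hG i).trans ((mk_le_mk_of_subset hsub).trans mk_range_le)) hlt.not_ge
  choose c hc hne using key
  let f : I → X := IsWellFounded.fix r c
  have hf : ∀ i, f i = c i (fun j _ => f j) := fun i => IsWellFounded.fix_eq r c i
  have hlt : ∀ i j, r j i → f j ≠ f i := by
    intro i j hj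
    rw [hf i]
    exact hne i (fun j _ => f j) j hj
  refine ⟨f, fun i j hij => ?_, fun i => hf i ▸ hc i _⟩
  rcases trichotomous_of r i j with h | h | h
  · exact absurd hij (hlt j i h)
  · exact h
  · exact absurd hij.symm (hlt i j h)

section Pinning

variable {X : Type u} [TopologicalSpace X] {κ : Cardinal.{u}}

/-- Open neighborhoods of distinct points can be met by a single small set. -/
theorem exists_meets_of_injective
    (hpin : ∀ U : X → Set X, IsNeighborhoodAssignment U → ∃ A : Set X, #A ≤ κ ∧ PinsDown A U)
    {I : Type u} (G : I → Set X) (hG : ∀ i, IsOpen (G i)) (f : I → X)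
    (hf : Function.Injective f) (hfG : ∀ i, f i ∈ G i) :
    ∃ A : Set X, #A ≤ κ ∧ ∀ i, (A ∩ G i).Nonempty := by
  obtain ⟨A, hA, hAU⟩ := hpin (Function.extend f G fun _ => univ) (by
    intro x
    by_cases hx : ∃ i, f i = x
    · obtain ⟨i, rfl⟩ := hx
      rw [hf.extend_apply]
      exact ⟨hG i, hfG i⟩
    · rw [Function.extend_apply' _ _ _ hx]
      exact ⟨isOpen_univ, mem_univ x⟩)
  refine ⟨A, hA, fun i => ?_⟩
  have := hAU (f i)
  rwa [hf.extend_apply] at this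

/-- Pairwise disjoint families of nonempty open sets are small. -/
theorem mk_le_of_pairwise_disjoint_open
    (hpin : ∀ U : X → Set X, IsNeighborhoodAssignment U → ∃ A : Set X, #A ≤ κ ∧ PinsDown A U)
    {I : Type u} (G : I → Set X) (hG : ∀ i, IsOpen (G i)) (hne : ∀ i, (G i).Nonempty)
    (hd : Pairwise fun i j => Disjoint (G i) (G j)) : #I ≤ κ := by
  have inj : ∀ f : I → X, (∀ i, f i ∈ G i) → Function.Injective f := by
    intro f hf i j hij
    by_contra hne
    exact (disjoint_left.1 (hd hne)) (hf i) (hij ▸ hf j)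
  choose f hf using hne
  obtain ⟨A, hA, hAG⟩ := exists_meets_of_injective hpin G hG f (inj f hf) hf
  choose g hg using hAG
  have hginj := inj g fun i => (hg i).2
  refine le_trans (mk_le_of_injective (f := fun i => (⟨g i, (hg i).1⟩ : A)) ?_) hA
  intro i j hij
  exact hginj (congrArg Subtype.val hij)

/-- In a regular space, a finite bound for pinning sets bounds the density. -/
theorem exists_dense_of_finite_pinning [RegularSpace X]
    (hpin : ∀ U : X → Set X, IsNeighborhoodAssignment U → ∃ A : Set X, #A ≤ κ ∧ PinsDown A U)
    (hκ : κ < ℵ₀) : ∃ D : Set X, Dense D ∧ #D ≤ κ := by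
  classical
  obtain ⟨n, rfl⟩ := lt_aleph0.1 hκ
  let P : ℕ → Prop := fun m => ∃ G : ULift.{u} (Fin m) → Set X,
    (∀ i, IsOpen (G i)) ∧ (∀ i, (G i).Nonempty) ∧ Pairwise fun i j => Disjoint (G i) (G j)
  have hbound : ∀ m, P m → m ≤ n := by
    rintro m ⟨G, h1, h2, h3⟩
    simpa using mk_le_of_pairwise_disjoint_open hpin G h1 h2 h3
  have h0 : P 0 := ⟨fun _ => ∅, fun i => i.down.elim0, fun i => i.down.elim0,
    fun i => i.down.elim0⟩
  have hm : P (Nat.findGreatest P n) := Nat.findGreatest_spec (Nat.zero_le n) h0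
  have hmax : ¬ P (Nat.findGreatest P n + 1) := fun h =>
    absurd (Nat.le_findGreatest (hbound _ h) h) (by omega)
  have hmn := hbound _ hm
  generalize Nat.findGreatest P n = m at hm hmax hmn
  obtain ⟨G, h1, h2, h3⟩ := hm
  choose f hf using h2
  refine ⟨range f, ?_, mk_range_le.trans (by simpa using hmn)⟩
  rw [dense_iff_inter_open]
  intro V hV hVne
  by_contra hcon
  obtain ⟨x, hx⟩ := hVne
  obtain ⟨C, hCx, hC, hCV⟩ := exists_mem_nhds_isClosed_subset (hV.mem_nhds hx)
  have hfC : ∀ i, f i ∉ C := fun i hi => hcon ⟨f i, hCV hi, mem_range_self i⟩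
  apply hmax
  -- Since `C` misses every `f i`, each `G i \ C` stays nonempty, and `interior C` is a further
  -- disjoint member.
  refine ⟨fun i => Fin.cases (interior C) (fun j => G ⟨j⟩ \ C) i.down, ?_, ?_, ?_⟩
  · rintro ⟨i⟩
    cases i using Fin.cases with
    | zero => exact isOpen_interior
    | succ j => exact (h1 ⟨j⟩).sdiff hC
  · rintro ⟨i⟩
    cases i using Fin.cases with
    | zero => exact ⟨x, mem_interior_iff_mem_nhds.2 hCx⟩
    | succ j => exact ⟨f ⟨j⟩, hf ⟨j⟩, hfC ⟨j⟩⟩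
  · rintro ⟨i⟩ ⟨j⟩ hij
    cases i using Fin.cases with
    | zero =>
      cases j using Fin.cases with
      | zero => exact absurd rfl hij
      | succ j => exact disjoint_sdiff_right.mono_left interior_subset
    | succ i =>
      cases j using Fin.cases with
      | zero => exact disjoint_sdiff_left.mono_right interior_subset
      | succ j =>
        refine (h3 (i := ⟨i⟩) (j := ⟨j⟩) ?_).mono sdiff_subset sdiff_subset
        rintro h
        exact hij (by rw [ULift.up.inj h])

/-- An open set of size at most `2 ^ κ`, all of whose nonempty open subsets have size at least
`2 ^ κ`, lies in the closure of a set of size at most `κ`. -/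
theorem exists_subset_closure_of_mk_le
    (hpin : ∀ U : X → Set X, IsNeighborhoodAssignment U → ∃ A : Set X, #A ≤ κ ∧ PinsDown A U)
    (hκ : ℵ₀ ≤ κ) {Y : Set X} (hY : IsOpen Y) (hYcard : #Y ≤ 2 ^ κ)
    (hbig : ∀ G ⊆ Y, IsOpen G → G.Nonempty → 2 ^ κ ≤ #G) :
    ∃ A : Set X, #A ≤ κ ∧ Y ⊆ closure A := by
  by_contra! hcon
  let I := {A : Set X // A ⊆ Y ∧ #A ≤ κ}
  have hI : #I ≤ 2 ^ κ := by
    refine (mk_bounded_subset_le Y κ).trans ?_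
    have h : max #Y ℵ₀ ≤ 2 ^ κ := max_le hYcard (hκ.trans (cantor κ).le)
    calc max #Y ℵ₀ ^ κ ≤ (2 ^ κ) ^ κ := power_le_power_right h
      _ = 2 ^ κ := by rw [← power_mul, mul_eq_self hκ]
  have hopen : ∀ i : I, IsOpen (Y \ closure i.1) := fun i => hY.sdiff isClosed_closure
  have hne : ∀ i : I, (Y \ closure i.1).Nonempty := fun i => sdiff_nonempty.2 (hcon i.1 i.2.2)
  obtain ⟨f, hf, hfG⟩ := exists_injective_forall_mem (fun i : I => Y \ closure i.1)
    fun i => hI.trans (hbig _ sdiff_subset (hopen i) (hne i))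
  obtain ⟨A, hA, hAG⟩ := exists_meets_of_injective hpin _ hopen f hf hfG
  -- The trace of the pinning set on `Y` is itself one of the indices, so it would meet the
  -- complement of its own closure.
  obtain ⟨x, hxA, hxY, hx⟩ :=
    hAG ⟨A ∩ Y, inter_subset_right, (mk_le_mk_of_subset inter_subset_left).trans hA⟩
  exact hx (subset_closure ⟨hxA, hxY⟩)

/-- An open set whose nonempty open subsets are larger than `2 ^ κ` contains at most `2 ^ κ`
regular open sets. -/
theorem mk_regularOpen_le
    (hpin : ∀ U : X → Set X, IsNeighborhoodAssignment U → ∃ A : Set X, #A ≤ κ ∧ PinsDown A U)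
    (hκ : ℵ₀ ≤ κ) {Z : Set X} (hbig : ∀ G ⊆ Z, IsOpen G → G.Nonempty → 2 ^ κ < #G) :
    #{G : Set X | interior (closure G) = G ∧ G ⊆ Z} ≤ 2 ^ κ := by
  by_contra! hlt
  -- With exactly the successor of 2^κ sets, the pairs are no more numerous than the points of any
  -- nonempty open subset of `Z`.
  obtain ⟨𝒢, h𝒢, hcard⟩ := le_mk_iff_exists_subset.1 (Order.succ_le_of_lt hlt)
  have hopen : ∀ G ∈ 𝒢, IsOpen G := fun G hG => (h𝒢 hG).1 ▸ isOpen_interior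
  let I := {p : 𝒢 × 𝒢 // (p.1.1 \ closure p.2.1).Nonempty}
  have hI : #I ≤ Order.succ (2 ^ κ) := by
    refine (mk_subtype_le _).trans ?_
    rw [mk_prod, Cardinal.lift_id, hcard]
    exact (mul_eq_self ((hκ.trans (cantor κ).le).trans (Order.le_succ _))).le
  have hIopen : ∀ i : I, IsOpen (i.1.1.1 \ closure i.1.2.1) := fun i =>
    (hopen _ i.1.1.2).sdiff isClosed_closure
  obtain ⟨f, hf, hfG⟩ := exists_injective_forall_mem
    (fun i : I => i.1.1.1 \ closure i.1.2.1) fun i => hI.trans (Order.succ_le_of_lt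
      (hbig _ (sdiff_subset.trans (h𝒢 i.1.1.2).2) (hIopen i) i.2))
  obtain ⟨A, hA, hAG⟩ := exists_meets_of_injective hpin _ hIopen f hf hfG
  -- Traces on `A` decide inclusion: `A` meets `G \ closure H` whenever it is nonempty, and `G ⊆
  -- closure H` gives `G ⊆ H` for regular open `H`. Hence there are at most 2^κ such sets.
  have hsub : ∀ G H : 𝒢, A ∩ G.1 ⊆ H.1 → G.1 ⊆ H.1 := by
    intro G H hGH
    by_contra hnot
    have hne : (G.1 \ closure H.1).Nonempty := by
      rw [sdiff_nonempty]
      intro hcl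
      exact hnot ((interior_maximal hcl (hopen _ G.2)).trans (h𝒢 H.2).1.subset)
    obtain ⟨x, hxA, hxG, hxH⟩ := hAG ⟨(G, H), hne⟩
    exact hxH (subset_closure (hGH ⟨hxA, hxG⟩))
  have hinj : Function.Injective fun G : 𝒢 => ((↑) ⁻¹' G.1 : Set A) := by
    intro G H hGH
    have hiff : ∀ x (hx : x ∈ A), x ∈ G.1 ↔ x ∈ H.1 := fun x hx =>
      Set.ext_iff.1 hGH ⟨x, hx⟩
    exact Subtype.ext (Subset.antisymm
      (hsub G H fun x hx => (hiff x hx.1).1 hx.2) (hsub H G fun x hx => (hiff x hx.1).2 hx.2))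
  have hle := mk_le_of_injective hinj
  rw [hcard, mk_set] at hle
  exact absurd (hle.trans (power_le_power_left two_ne_zero hA)) (Order.lt_succ _).not_ge

/-- In a regular space, an open set whose nonempty open subsets are larger than `2 ^ κ` lies in the
closure of a set of size at most `κ`. -/
theorem exists_subset_closure_of_lt_mk [RegularSpace X]
    (hpin : ∀ U : X → Set X, IsNeighborhoodAssignment U → ∃ A : Set X, #A ≤ κ ∧ PinsDown A U)
    (hκ : ℵ₀ ≤ κ) {Z : Set X} (hZ : IsOpen Z)
    (hbig : ∀ G ⊆ Z, IsOpen G → G.Nonempty → 2 ^ κ < #G) :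
    ∃ A : Set X, #A ≤ κ ∧ Z ⊆ closure A := by
  let I := {G : {G : Set X | interior (closure G) = G ∧ G ⊆ Z} // G.1.Nonempty}
  have hI : #I ≤ 2 ^ κ := (mk_subtype_le _).trans (mk_regularOpen_le hpin hκ hbig)
  have hopen : ∀ i : I, IsOpen i.1.1 := fun i => i.1.2.1 ▸ isOpen_interior
  obtain ⟨f, hf, hfG⟩ := exists_injective_forall_mem (fun i : I => i.1.1)
    fun i => hI.trans (hbig _ i.1.2.2 (hopen i) i.2).le
  obtain ⟨A, hA, hAG⟩ := exists_meets_of_injective hpin _ hopen f hf hfG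
  refine ⟨A, hA, fun x hx => mem_closure_iff.2 fun V hV hxV => ?_⟩
  obtain ⟨C, hCx, hC, hCV⟩ := exists_mem_nhds_isClosed_subset ((hV.inter hZ).mem_nhds ⟨hxV, hx⟩)
  have hsub : interior (closure (interior C)) ⊆ V ∩ Z :=
    interior_subset.trans ((closure_minimal interior_subset hC).trans hCV)
  have hxC : x ∈ interior (closure (interior C)) :=
    interior_maximal subset_closure isOpen_interior (mem_interior_iff_mem_nhds.2 hCx)
  obtain ⟨y, hyA, hy⟩ := hAG ⟨⟨interior (closure (interior C)),
    interior_closure_idem, hsub.trans inter_subset_right⟩, x, hxC⟩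
  exact ⟨y, (hsub hy).1, hyA⟩

/-- In a regular space whose nonempty open sets have size at least `2 ^ κ`, an infinite bound `κ`
for pinning sets bounds the density. -/
theorem exists_dense_of_infinite_pinning [RegularSpace X]
    (hpin : ∀ U : X → Set X, IsNeighborhoodAssignment U → ∃ A : Set X, #A ≤ κ ∧ PinsDown A U)
    (hκ : ℵ₀ ≤ κ) (hbig : ∀ G : Set X, IsOpen G → G.Nonempty → 2 ^ κ ≤ #G) :
    ∃ D : Set X, Dense D ∧ #D ≤ κ := by
  obtain ⟨𝒞, h𝒞⟩ := zorn_subset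
    {𝒞 : Set (Set X) | (∀ G ∈ 𝒞, IsOpen G ∧ G.Nonempty ∧ #G ≤ 2 ^ κ) ∧ 𝒞.Pairwise Disjoint} (by
      intro c hc hchain
      refine ⟨⋃₀ c, ⟨?_, ?_⟩, fun s hs => subset_sUnion_of_mem hs⟩
      · rintro G ⟨s, hs, hG⟩
        exact (hc hs).1 G hG
      · exact (pairwise_sUnion hchain.directedOn).2 fun s hs => (hc hs).2)
  obtain ⟨hmem, hdisj⟩ := h𝒞.prop
  have hcard : #𝒞 ≤ κ := mk_le_of_pairwise_disjoint_open hpin (fun G : 𝒞 => G.1)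
    (fun G => (hmem _ G.2).1) (fun G => (hmem _ G.2).2.1)
    fun G H hGH => hdisj G.2 H.2 fun h => hGH (Subtype.ext h)
  have hYopen : IsOpen (⋃₀ 𝒞) := isOpen_sUnion fun G hG => (hmem G hG).1
  have hYcard : #(⋃₀ 𝒞) ≤ 2 ^ κ := by
    refine (mk_sUnion_le 𝒞).trans ?_
    calc #𝒞 * ⨆ s : 𝒞, #s ≤ 2 ^ κ * 2 ^ κ :=
          mul_le_mul' (hcard.trans (cantor κ).le) (ciSup_le' fun s => (hmem _ s.2).2.2)
      _ = 2 ^ κ := mul_eq_self (hκ.trans (cantor κ).le)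
  obtain ⟨A, hA, hYA⟩ := exists_subset_closure_of_mk_le hpin hκ hYopen hYcard
    fun G _ => hbig G
  obtain ⟨B, hB, hZB⟩ := exists_subset_closure_of_lt_mk hpin hκ
    (Z := (closure (⋃₀ 𝒞))ᶜ) isClosed_closure.isOpen_compl (by
      intro G hGZ hG hGne
      by_contra! hle
      have hGd : ∀ H ∈ 𝒞, Disjoint G H := fun H hH =>
        disjoint_left.2 fun x hxG hxH => hGZ hxG (subset_closure ⟨H, hH, hxH⟩)
      -- Maximality puts `G` into the family, so `G` would be disjoint from itself.
      have hins : G ∈ 𝒞 := h𝒞.le_of_ge (y := insert G 𝒞)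
        ⟨forall_mem_insert.2 ⟨⟨hG, hGne, hle⟩, hmem⟩,
          hdisj.insert fun H hH _ => ⟨hGd H hH, (hGd H hH).symm⟩⟩
        (subset_insert G 𝒞) (mem_insert G 𝒞)
      obtain ⟨x, hx⟩ := hGne
      exact disjoint_left.1 (hGd G hins) hx hx)
  refine ⟨A ∪ B, fun x => ?_, ?_⟩
  · rw [closure_union]
    by_cases hx : x ∈ closure (⋃₀ 𝒞)
    · exact Or.inl (closure_minimal hYA isClosed_closure hx)
    · exact Or.inr (hZB hx)
  · exact (mk_union_le A B).trans (add_le_of_le hκ hA hB)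

end Pinning

/-- The pinning down number is attained. -/
theorem exists_pinsDown_mk_eq (X : Type u) [TopologicalSpace X] (U : X → Set X)
    (hU : IsNeighborhoodAssignment U) :
    ∃ A : Set X, #A = pinningDownNumber X ∧ PinsDown A U :=
  csInf_mem (s := {κ | ∀ U : X → Set X, IsNeighborhoodAssignment U →
    ∃ A : Set X, #A = κ ∧ PinsDown A U})
    ⟨#X, fun _ hU => ⟨univ, mk_univ, fun x => ⟨x, mem_univ x, (hU x).2⟩⟩⟩ U hU

theorem mainTheorem6 (X : Type u) [TopologicalSpace X] [RegularSpace X]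
    (h : pinningDownNumber X < densityNumber X) :
    dispersionCharacter X < (2 : Cardinal.{u}) ^ pinningDownNumber X := by
  by_contra! hle
  have hpin : ∀ U : X → Set X, IsNeighborhoodAssignment U →
      ∃ A : Set X, #A ≤ pinningDownNumber X ∧ PinsDown A U := fun U hU =>
    let ⟨A, hA, hAU⟩ := exists_pinsDown_mk_eq X U hU
    ⟨A, hA.le, hAU⟩
  have hD : ∃ D : Set X, Dense D ∧ #D ≤ pinningDownNumber X := by
    rcases lt_or_ge (pinningDownNumber X) ℵ₀ with hκ | hκ
    · exact exists_dense_of_finite_pinning hpin hκ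
    · exact exists_dense_of_infinite_pinning hpin hκ fun G hG hGne =>
        hle.trans (csInf_le' ⟨G, hG, hGne, rfl⟩)
  obtain ⟨D, hD, hDcard⟩ := hD
  have hd : densityNumber X ≤ #D := csInf_le' ⟨D, hD, rfl⟩
  exact absurd (hd.trans hDcard) h.not_ge
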